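/- Let $n \ge 2$ and $k \ge 2$ be integers. In permutation Mastermind the codemaker chooses a secret permutation $\sigma^\star$ of $[n]$; in each round the codebreaker guesses a permutation $\pi_t$ of $[n]$ and receives the score $b(\pi_t,\sigma^\star) = |\{i \in [n] : \pi_t(i) = \sigma^\star(i)\}|$, and the codebreaker wins with the guess $\pi_t = \sigma^\star$. A (deterministic) adaptive strategy maps the transcript of previous guesses and scores to the next guess; it is $\ell_k$-local if any two consecutive guesses that it makes differ in at most $k$ positions. Let $A_\ell(n,k)$ be the least $T$ such that some $\ell_k$-local adaptive strategy wins within $T$ guesses (the winning guess included) against every secret; this minimum exists. Then $$\frac{n^2-3n}{2k} \le A_\ell(n,k) \quad \text{for all } n,k \ge 2,$$ and $$A_\ell(n,k) \le \frac{n^2 \lg n}{k}\,(1+o(1)) \quad \text{for all } 2 \le k \le n,$$ where $\lg$ is the logarithm to base $2$ and the $o(1)$ term depends only on $n$ and tends to $0$ as $n \to \infty$, uniformly in $2 \le k \le n$. -/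

import Mathlib

open Filter Topology

/-- The black-peg score of the guess `π` against the secret `σ`: the number of positions
where they agree. -/
def blackPegs {n : ℕ} (π σ : Equiv.Perm (Fin n)) : ℕ :=
  (Finset.univ.filter fun i => π i = σ i).card

/-- The set of positions in which two permutations differ. -/
def diffSet {n : ℕ} (π σ : Equiv.Perm (Fin n)) : Finset (Fin n) :=
  Finset.univ.filter fun i => π i ≠ σ i

/-- A deterministic adaptive strategy of the codebreaker: it maps the transcript so far, the list
of previous guesses (oldest first) with the scores received, to the next guess. -/
abbrev AdaptiveStrategy (n : ℕ) : Type :=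
  List (Equiv.Perm (Fin n) × ℕ) → Equiv.Perm (Fin n)

/-- The transcript after `t` rounds when the strategy `S` is played against the secret `σ`. -/
def transcript {n : ℕ} (S : AdaptiveStrategy n) (σ : Equiv.Perm (Fin n)) :
    ℕ → List (Equiv.Perm (Fin n) × ℕ)
  | 0 => []
  | t + 1 =>
      transcript S σ t ++ [(S (transcript S σ t), blackPegs (S (transcript S σ t)) σ)]

/-- The guess that `S` makes against the secret `σ` after `t` completed rounds; thus
`guess S σ 0` is the first guess. -/
def guess {n : ℕ} (S : AdaptiveStrategy n) (σ : Equiv.Perm (Fin n)) (t : ℕ) :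
    Equiv.Perm (Fin n) :=
  S (transcript S σ t)

/-- A strategy is `ℓ_k`-local if, in every play, any two consecutive guesses differ in at most
`k` positions. (Rounds after the winning guess are harmless: there a strategy may repeat it.) -/
def IsEllLocal {n : ℕ} (k : ℕ) (S : AdaptiveStrategy n) : Prop :=
  ∀ (σ : Equiv.Perm (Fin n)) (t : ℕ), (diffSet (guess S σ t) (guess S σ (t + 1))).card ≤ k

/-- Against every secret, one of the first `T` guesses of `S` equals the secret. -/
def WinsWithin {n : ℕ} (S : AdaptiveStrategy n) (T : ℕ) : Prop :=
  ∀ σ : Equiv.Perm (Fin n), ∃ t < T, guess S σ t = σ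

/-- The numbers `T` such that some `ℓ_k`-local adaptive strategy always wins within `T`
guesses. -/
def ellWinningBounds (n k : ℕ) : Set ℕ :=
  {T | ∃ S : AdaptiveStrategy n, IsEllLocal k S ∧ WinsWithin S T}

/-- `A_ℓ(n,k)`: the minimum worst-case number of guesses of an `ℓ_k`-local adaptive strategy. -/
noncomputable def adaptiveEll (n k : ℕ) : ℕ :=
  sInf (ellWinningBounds n k)

/-!
Lower bound. Choose the secret `σ` greedily, so that each score is the least one consistent with
the earlier answers (`exists_greedy_secret`). If, for some `i ≠ j`, neither of the pairs
`(i, σ j)`, `(j, σ i)` had been queried before `σ` is guessed, then `σ * swap i j` would score at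
most as much as `σ` in every round; by greediness it would produce the same transcript, and it
would score strictly less once `σ` itself is guessed (`queried_or_queried`). Hence at least
`n (n - 1) / 2` pairs are queried before the win, while a local strategy queries `n` pairs with
the first guess and at most `k` new ones with each further guess.

Upper bound. `Solvable` describes the positions from which the codebreaker can win, in terms of
the last guess and the set of secrets still possible. Since `q = k / 2` transpositions can be
carried out in one guess, any guess can be reached from any other within `n / q + 1` guesses
(`Solvable.move`). First the codebreaker guesses `2 n` fixed permutations. They contain a guess
`g` of score `0` (`exists_blackPegs_eq_zero`), and every pair (position, value) occurs in one of
them. As long as some value of the secret is unknown, some permutation `s` of this list has a hit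
outside the known positions; such hits can be counted, because the contribution of the known
positions to any score is known. On a path of `n` transpositions from `g` to `s`, binary search
finds a step at which such hits appear (`Solvable.binary_search`), and one more guess
tells which of the two positions changed in this step carries one (`openHits_three_cycle`). The
search takes `⌈lg n⌉` queries whose distances along the path are halved each time, so locality
costs only `O(n / k)` further guesses. Finding all `n` values thus takes
`n lg n + O(n² / k) = (n² lg n / k) (1 + O(1 / lg n))` guesses, since `k ≤ n`.
-/

section

variable {n : ℕ}

/-! ### Transcripts and greedy secrets -/

theorem guess_congr {S : AdaptiveStrategy n} {σ σ' : Equiv.Perm (Fin n)} {t : ℕ}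
    (h : transcript S σ' t = transcript S σ t) : guess S σ' t = guess S σ t := by
  simp only [guess, h]

theorem transcript_succ_eq_iff {S : AdaptiveStrategy n} {σ σ' : Equiv.Perm (Fin n)} {t : ℕ} :
    transcript S σ' (t + 1) = transcript S σ (t + 1) ↔
      transcript S σ' t = transcript S σ t ∧
        blackPegs (guess S σ t) σ' = blackPegs (guess S σ t) σ := by
  constructor
  · intro h
    simp only [transcript] at h
    have h1 := List.append_inj' h rfl
    refine ⟨h1.1, ?_⟩
    have h2 := h1.2
    rw [h1.1] at h2
    simpa [guess] using h2
  · rintro ⟨h1, h2⟩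
    simp only [guess] at h2
    simp only [transcript, h1, h2]

theorem transcript_eq_of_le {S : AdaptiveStrategy n} {σ σ' : Equiv.Perm (Fin n)} {s t : ℕ}
    (hst : s ≤ t) (h : transcript S σ' t = transcript S σ t) :
    transcript S σ' s = transcript S σ s := by
  induction hst with
  | refl => exact h
  | step _ ih => exact ih (transcript_succ_eq_iff.1 h).1

/-- A secret whose scores in the first `T` rounds are greedily minimal: each score is the least
one that is still consistent with the earlier answers. -/
theorem exists_greedy_secret (S : AdaptiveStrategy n) (T : ℕ) :
    ∃ σ, ∀ t < T, ∀ σ', transcript S σ' t = transcript S σ t →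
      blackPegs (guess S σ t) σ ≤ blackPegs (guess S σ t) σ' := by
  induction T with
  | zero => exact ⟨1, by simp⟩
  | succ T ih =>
    obtain ⟨σ, hσ⟩ := ih
    obtain ⟨ρ, hρ, hmin⟩ := Set.exists_min_image
      {σ' | transcript S σ' T = transcript S σ T} (fun σ' => blackPegs (guess S σ T) σ')
      (Set.toFinite _) ⟨σ, rfl⟩
    have hρ : transcript S ρ T = transcript S σ T := hρ
    refine ⟨ρ, fun t ht σ' h => ?_⟩
    have hle : t ≤ T := Nat.lt_succ_iff.1 ht
    have hρt := transcript_eq_of_le hle hρ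
    rw [guess_congr hρt]
    rcases hle.eq_or_lt with rfl | hlt
    · exact hmin σ' (h.trans hρ)
    · -- the scores of `ρ` and `σ` agree before round `T`
      have := (transcript_succ_eq_iff.1 (transcript_eq_of_le hlt hρ)).2
      rw [this]
      exact hσ t hlt σ' (h.trans hρt)

theorem blackPegs_mul_swap_le {π σ : Equiv.Perm (Fin n)} {i j : Fin n}
    (h₁ : π i ≠ σ j) (h₂ : π j ≠ σ i) :
    blackPegs π (σ * Equiv.swap i j) ≤ blackPegs π σ := by
  refine Finset.card_le_card fun x hx => ?_
  replace hx : π x = σ (Equiv.swap i j x) := (Finset.mem_filter.1 hx).2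
  refine Finset.mem_filter.2 ⟨Finset.mem_univ x, ?_⟩
  by_cases hi : x = i
  · subst hi; rw [Equiv.swap_apply_left] at hx; exact absurd hx h₁
  by_cases hj : x = j
  · subst hj; rw [Equiv.swap_apply_right] at hx; exact absurd hx h₂
  rwa [Equiv.swap_apply_of_ne_of_ne hi hj] at hx

theorem blackPegs_eq_iff {π σ : Equiv.Perm (Fin n)} : blackPegs π σ = n ↔ π = σ := by
  constructor
  · intro h
    have : (Finset.univ.filter fun i => π i = σ i) = Finset.univ := by
      rw [← Finset.card_eq_iff_eq_univ, Fintype.card_fin]; exact h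
    ext i
    rw [Finset.filter_eq_self.1 this i (Finset.mem_univ i)]
  · rintro rfl; simp [blackPegs]

theorem blackPegs_le (π σ : Equiv.Perm (Fin n)) : blackPegs π σ ≤ n :=
  (Finset.card_le_univ _).trans (Fintype.card_fin n).le

/-! ### Queried pairs and the lower bound -/

/-- The (position, value) pairs that occur in the first `t` guesses. -/
def queriedPairs (S : AdaptiveStrategy n) (σ : Equiv.Perm (Fin n)) (t : ℕ) :
    Finset (Fin n × Fin n) :=
  Finset.univ.filter fun p => ∃ s < t, guess S σ s p.1 = p.2

/-- Before the greedy secret `σ` is guessed, at least one of the two pairs that distinguish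
`σ * swap i j` from `σ` has been queried: otherwise `σ * swap i j` would never score higher than
`σ`, and strictly less when `σ` is guessed. -/
theorem queried_or_queried {S : AdaptiveStrategy n} {σ : Equiv.Perm (Fin n)} {τ : ℕ}
    (hσ : ∀ t < τ + 1, ∀ σ', transcript S σ' t = transcript S σ t →
      blackPegs (guess S σ t) σ ≤ blackPegs (guess S σ t) σ')
    (hwin : guess S σ τ = σ) {i j : Fin n} (hij : i ≠ j) :
    (i, σ j) ∈ queriedPairs S σ τ ∨ (j, σ i) ∈ queriedPairs S σ τ := by
  by_contra! hcon
  simp only [queriedPairs, Finset.mem_filter, Finset.mem_univ, true_and, not_exists,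
    not_and] at hcon
  have key : ∀ t ≤ τ, transcript S (σ * Equiv.swap i j) t = transcript S σ t := by
    intro t
    induction t with
    | zero => intro _; rfl
    | succ t ih =>
      intro ht
      have h := ih (by omega)
      exact transcript_succ_eq_iff.2 ⟨h, le_antisymm
        (blackPegs_mul_swap_le (hcon.1 t ht) (hcon.2 t ht)) (hσ t (by omega) _ h)⟩
  have h := hσ τ (by omega) _ (key τ le_rfl)
  rw [hwin, blackPegs_eq_iff.2 rfl] at h
  have h' := blackPegs_eq_iff.1 (le_antisymm (blackPegs_le _ _) h)
  have h2 : σ i = σ j := by simpa using congrArg (fun f => f i) h'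
  exact hij (σ.injective h2)

/-- The first guess queries `n` pairs, and each later one at most `k` new pairs. -/
theorem card_queriedPairs_le {S : AdaptiveStrategy n} {k : ℕ} (hS : IsEllLocal k S)
    (σ : Equiv.Perm (Fin n)) (t : ℕ) : (queriedPairs S σ (t + 1)).card ≤ n + t * k := by
  induction t with
  | zero =>
    have : queriedPairs S σ (0 + 1) ⊆
        Finset.univ.image fun i => (i, guess S σ 0 i) := by
      rintro ⟨a, b⟩ h
      simp only [queriedPairs, Finset.mem_filter, Finset.mem_univ, true_and] at h
      obtain ⟨s, hs, h⟩ := h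
      obtain rfl : s = 0 := by omega
      simp [← h]
    refine (Finset.card_le_card this).trans (Finset.card_image_le.trans ?_)
    simp
  | succ t ih =>
    have : queriedPairs S σ (t + 1 + 1) ⊆ queriedPairs S σ (t + 1) ∪
        (diffSet (guess S σ t) (guess S σ (t + 1))).image
          fun i => (i, guess S σ (t + 1) i) := by
      rintro ⟨a, b⟩ h
      simp only [queriedPairs, Finset.mem_filter, Finset.mem_univ, true_and, Finset.mem_union,
        Finset.mem_image, diffSet] at h ⊢
      obtain ⟨s, hs, h⟩ := h
      rcases Nat.lt_succ_iff_lt_or_eq.1 hs with hs | rfl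
      · exact Or.inl ⟨s, hs, h⟩
      · by_cases hd : guess S σ t a = guess S σ (t + 1) a
        · exact Or.inl ⟨t, by omega, hd.trans h⟩
        · exact Or.inr ⟨a, hd, by rw [h]⟩
    calc _ ≤ _ := Finset.card_le_card this
      _ ≤ _ := Finset.card_union_le _ _
      _ ≤ (n + t * k) + k := Nat.add_le_add ih (Finset.card_image_le.trans (hS σ t))
      _ = _ := by ring

/-- A set of pairs meeting `{(i, σ j), (j, σ i)}` for all `i ≠ j` has at least `n (n - 1) / 2`
elements. -/
theorem sq_le_two_mul_card_add_of_forall_or {P : Finset (Fin n × Fin n)} (σ : Equiv.Perm (Fin n))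
    (h : ∀ i j, i ≠ j → (i, σ j) ∈ P ∨ (j, σ i) ∈ P) : n * n ≤ 2 * P.card + n := by
  -- off the diagonal, every pair or its mirror image lies in `Q`
  let Q : Finset (Fin n × Fin n) := Finset.univ.filter fun p => (p.1, σ p.2) ∈ P
  have hQ : Q.card ≤ P.card := Finset.card_le_card_of_injOn (fun p => (p.1, σ p.2))
    (fun p hp => (Finset.mem_filter.1 hp).2) (fun p _ q _ hpq => by
      simp only [Prod.mk.injEq, EmbeddingLike.apply_eq_iff_eq] at hpq
      exact Prod.ext hpq.1 hpq.2)
  have hcov : (Finset.univ : Finset (Fin n × Fin n)) ⊆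
      Q ∪ Q.image Prod.swap ∪ Finset.univ.image fun i => (i, i) := by
    rintro ⟨i, j⟩ -
    by_cases hij : i = j
    · simp [hij]
    · rcases h i j hij with h | h
      · simp [Q, h]
      · simp [Q, h]
  have h1 := Finset.card_le_card hcov
  have h2 := Finset.card_union_le (Q ∪ Q.image Prod.swap)
    (Finset.univ.image fun i : Fin n => (i, i))
  have h3 := Finset.card_union_le Q (Q.image Prod.swap)
  have h4 : (Q.image Prod.swap).card ≤ Q.card := Finset.card_image_le
  have h5 : (Finset.univ.image fun i : Fin n => (i, i)).card ≤ n := by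
    simpa using Finset.card_image_le (s := Finset.univ) (f := fun i : Fin n => (i, i))
  simp only [Finset.card_univ, Fintype.card_prod, Fintype.card_fin] at h1
  omega

/-- The lower bound `(n² - 3n) / (2k) ≤ T`, cleared of denominators. -/
theorem sq_le_of_mem_ellWinningBounds {k T : ℕ} (hn : 2 ≤ n)
    (hT : T ∈ ellWinningBounds n k) : n * n ≤ 2 * (T * k) + 3 * n := by
  obtain ⟨S, hloc, hwin⟩ := hT
  obtain ⟨σ, hσ⟩ := exists_greedy_secret S T
  obtain ⟨τ, hτ, hg⟩ := hwin σ
  have hP := sq_le_two_mul_card_add_of_forall_or σ fun i j hij =>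
    queried_or_queried (fun t ht => hσ t (by omega)) hg hij
  cases τ with
  | zero =>
    -- without any earlier query the inequality reads `n * n ≤ n`
    have : (queriedPairs S σ 0).card = 0 := by simp [queriedPairs]
    nlinarith
  | succ τ =>
    have h := card_queriedPairs_le hloc σ τ
    have : τ * k ≤ T * k := Nat.mul_le_mul_right k (by omega)
    omega

/-! ### Distances between guesses -/

theorem diffSet_comm (π π' : Equiv.Perm (Fin n)) : diffSet π π' = diffSet π' π := by
  simp only [diffSet, ne_comm]

theorem card_diffSet_triangle (π π' π'' : Equiv.Perm (Fin n)) :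
    (diffSet π π'').card ≤ (diffSet π π').card + (diffSet π' π'').card := by
  refine (Finset.card_le_card fun i hi => ?_).trans (Finset.card_union_le _ _)
  simp only [diffSet, Finset.mem_filter, Finset.mem_univ, true_and, Finset.mem_union] at hi ⊢
  by_contra! h
  exact hi (h.1.trans h.2)

theorem card_diffSet_self (π : Equiv.Perm (Fin n)) : (diffSet π π).card = 0 := by
  simp [diffSet]

theorem card_diffSet_mul_swap_le (π : Equiv.Perm (Fin n)) (a b : Fin n) :
    (diffSet π (π * Equiv.swap a b)).card ≤ 2 := by
  refine (Finset.card_le_card (t := {a, b}) fun i hi => ?_).trans Finset.card_le_two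
  simp only [diffSet, Finset.mem_filter, Finset.mem_univ, true_and] at hi
  by_contra! h
  simp only [Finset.mem_insert, Finset.mem_singleton, not_or] at h
  exact hi (by simp [Equiv.swap_apply_of_ne_of_ne h.1 h.2])

/-! ### Winning positions -/

/-- `Solvable k t π C`: if the guess `π` is being made and the secret is known to lie in `C`, then
the codebreaker can continue `ℓ_k`-locally so as to win with `π` or one of the next `t` guesses. -/
def Solvable (k : ℕ) : ℕ → Equiv.Perm (Fin n) → Set (Equiv.Perm (Fin n)) → Prop
  | 0, π, C => ∀ σ ∈ C, σ = π
  | t + 1, π, C => ∀ b : ℕ, ∃ π', (diffSet π π').card ≤ k ∧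
      Solvable k t π' {σ ∈ C | blackPegs π σ = b}

theorem transcript_cons {S : AdaptiveStrategy n} {S' : ℕ → AdaptiveStrategy n}
    {π : Equiv.Perm (Fin n)} (h0 : S [] = π) (hS : ∀ p b l, S ((p, b) :: l) = S' b l)
    (σ : Equiv.Perm (Fin n)) (t : ℕ) :
    transcript S σ (t + 1) =
      (π, blackPegs π σ) :: transcript (S' (blackPegs π σ)) σ t := by
  induction t with
  | zero => simp [transcript, h0]
  | succ t ih => rw [transcript, ih, hS]; simp [transcript]

/-- A winning position yields a strategy: the answer to the first guess selects the strategy with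
which to continue. -/
theorem Solvable.exists_strategy {k t : ℕ} {π : Equiv.Perm (Fin n)}
    {C : Set (Equiv.Perm (Fin n))} (h : Solvable k t π C) :
    ∃ S : AdaptiveStrategy n, S [] = π ∧ IsEllLocal k S ∧
      ∀ σ ∈ C, ∃ s < t + 1, guess S σ s = σ := by
  induction t generalizing π C with
  | zero =>
    refine ⟨fun _ => π, rfl, fun σ t => ?_, fun σ hσ => ⟨0, by omega, (h σ hσ).symm⟩⟩
    simp [guess, card_diffSet_self]
  | succ t ih =>
    choose π' hd hπ' using h
    choose S' hS0 hloc hwin using fun b => ih (hπ' b)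
    let S : AdaptiveStrategy n := fun l => match l with
      | [] => π
      | (_, b) :: l => S' b l
    have hguess : ∀ σ t, guess S σ (t + 1) = guess (S' (blackPegs π σ)) σ t := fun σ t => by
      rw [guess, transcript_cons (S := S) rfl (fun _ _ _ => rfl)]; rfl
    refine ⟨S, rfl, fun σ t => ?_, fun σ hσ => ?_⟩
    · cases t with
      | zero =>
        rw [hguess]
        change (diffSet π (S' _ [])).card ≤ k
        rw [hS0]
        exact hd _
      | succ t => rw [hguess, hguess]; exact hloc _ σ t
    · obtain ⟨s, hs, h⟩ := hwin (blackPegs π σ) σ ⟨hσ, rfl⟩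
      exact ⟨s + 1, by omega, by rw [hguess, h]⟩

namespace Solvable

variable {k t : ℕ} {π π' : Equiv.Perm (Fin n)} {C C' : Set (Equiv.Perm (Fin n))}

theorem subset (h : Solvable k t π C) (hC : C' ⊆ C) : Solvable k t π C' := by
  induction t generalizing π C C' with
  | zero => exact fun σ hσ => h σ (hC hσ)
  | succ t ih =>
    intro b
    obtain ⟨π', hd, h'⟩ := h b
    exact ⟨π', hd, ih h' fun σ hσ => ⟨hC hσ.1, hσ.2⟩⟩

theorem step (hd : (diffSet π π').card ≤ k) (h : Solvable k t π' C) :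
    Solvable k (t + 1) π C :=
  fun _ => ⟨π', hd, h.subset fun _ hσ => hσ.1⟩

theorem mono {t' : ℕ} (h : Solvable k t π C) (ht : t ≤ t') : Solvable k t' π C := by
  induction ht with
  | refl => exact h
  | step _ ih =>
    -- repeating a guess is a legal move
    exact step (by simp [card_diffSet_self]) ih

theorem empty : Solvable k t π ∅ :=
  mono (t := 0) (fun _ h => h.elim) (Nat.zero_le t)

/-- The answer to the current guess may be used right away. -/
theorem of_blackPegs (h : ∀ b, Solvable k t π {σ ∈ C | blackPegs π σ = b}) :
    Solvable k t π C := by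
  cases t with
  | zero => exact fun σ hσ => h _ σ ⟨hσ, rfl⟩
  | succ t =>
    intro b
    obtain ⟨π', hd, h'⟩ := h b b
    exact ⟨π', hd, h'.subset fun σ hσ => ⟨hσ, hσ.2⟩⟩

end Solvable

/-! ### Moving along paths of transpositions -/

theorem card_diffSet_path_le {p : ℕ → Equiv.Perm (Fin n)}
    (hp : ∀ i, (diffSet (p i) (p (i + 1))).card ≤ 2) (i d : ℕ) :
    (diffSet (p i) (p (i + d))).card ≤ 2 * d := by
  induction d with
  | zero => simp [card_diffSet_self]
  | succ d ih =>
    have := card_diffSet_triangle (p i) (p (i + d)) (p (i + (d + 1)))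
    have := hp (i + d)
    rw [← add_assoc] at *
    omega

namespace Solvable

variable {k t : ℕ} {π : Equiv.Perm (Fin n)} {C : Set (Equiv.Perm (Fin n))}

/-- One guess can advance `k / 2` steps along a path of transpositions. -/
theorem move_forward (hk : 2 ≤ k) {p : ℕ → Equiv.Perm (Fin n)}
    (hp : ∀ i, (diffSet (p i) (p (i + 1))).card ≤ 2) (i d : ℕ)
    (h : Solvable k t (p (i + d)) C) : Solvable k (t + (d / (k / 2) + 1)) (p i) C := by
  have hq : 0 < k / 2 := Nat.div_pos hk (by norm_num)
  induction d using Nat.strong_induction_on generalizing i with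
  | _ d ih =>
    rcases lt_or_ge d (k / 2) with hd | hd
    · rw [Nat.div_eq_of_lt hd]
      exact step ((card_diffSet_path_le hp i d).trans (by omega)) h
    · have hd' : d = (d - k / 2) + k / 2 := by omega
      have h1 := ih (d - k / 2) (by omega) (i + k / 2)
        (by rwa [show i + k / 2 + (d - k / 2) = i + d by omega])
      have h2 := step (((card_diffSet_path_le hp i (k / 2))).trans (by omega)) h1
      refine h2.mono ?_
      conv_rhs => rw [hd', Nat.add_div_right _ hq]
      omega

theorem move_backward (hk : 2 ≤ k) {p : ℕ → Equiv.Perm (Fin n)}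
    (hp : ∀ i, (diffSet (p i) (p (i + 1))).card ≤ 2) (i d : ℕ)
    (h : Solvable k t (p i) C) : Solvable k (t + (d / (k / 2) + 1)) (p (i + d)) C := by
  have := move_forward (t := t) (C := C) hk (p := fun j => p (i + d - j)) (fun j => ?_) 0 d
    (by simpa using h)
  · simpa using this
  · rcases lt_or_ge j (i + d) with hj | hj
    · rw [diffSet_comm, show i + d - j = (i + d - (j + 1)) + 1 by omega]
      exact hp _
    · rw [show i + d - j = 0 by omega, show i + d - (j + 1) = 0 by omega, card_diffSet_self]
      omega

end Solvable

/-- A path of transpositions from `g` to `s`: step `i` brings position `i` to its value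
under `s`; from step `n` on the path rests at `s`. -/
def swapPath (g s : Equiv.Perm (Fin n)) : ℕ → Equiv.Perm (Fin n)
  | 0 => g
  | i + 1 =>
    if h : i < n then
      swapPath g s i * Equiv.swap ⟨i, h⟩ ((swapPath g s i)⁻¹ (s ⟨i, h⟩))
    else swapPath g s i

theorem swapPath_succ (hn : 0 < n) (g s : Equiv.Perm (Fin n)) (i : ℕ) :
    ∃ a b, swapPath g s (i + 1) = swapPath g s i * Equiv.swap a b := by
  rw [swapPath]
  split_ifs with h
  · exact ⟨_, _, rfl⟩
  · exact ⟨⟨0, hn⟩, ⟨0, hn⟩, by rw [Equiv.swap_self]; rfl⟩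

theorem card_diffSet_swapPath_le (g s : Equiv.Perm (Fin n)) (i : ℕ) :
    (diffSet (swapPath g s i) (swapPath g s (i + 1))).card ≤ 2 := by
  rw [swapPath]
  split_ifs with h
  · exact card_diffSet_mul_swap_le _ _ _
  · simp [card_diffSet_self]

theorem swapPath_apply (g s : Equiv.Perm (Fin n)) (i : ℕ) (j : Fin n) (hj : (j : ℕ) < i) :
    swapPath g s i j = s j := by
  induction i with
  | zero => omega
  | succ i ih =>
    rw [swapPath]
    split_ifs with h
    · rw [Equiv.Perm.mul_apply]
      by_cases hji : j = ⟨i, h⟩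
      · simp [hji]
      · have hlt : (j : ℕ) < i := by
          have : (j : ℕ) ≠ i := fun e => hji (Fin.ext e)
          omega
        have hne : j ≠ (swapPath g s i)⁻¹ (s ⟨i, h⟩) := by
          intro e
          have h1 : swapPath g s i j = s ⟨i, h⟩ := by rw [e]; simp
          rw [ih hlt] at h1
          exact hji (s.injective h1)
        rw [Equiv.swap_apply_of_ne_of_ne hji hne, ih hlt]
    · exact ih (by omega)

theorem swapPath_of_le (g s : Equiv.Perm (Fin n)) {i : ℕ} (hi : n ≤ i) : swapPath g s i = s :=
  Equiv.ext fun j => swapPath_apply g s i j (by omega)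

/-! ### Hits outside the known positions and binary search -/

/-- The number of positions outside `K` at which `π` and `σ` agree. -/
def openHits (K : Finset (Fin n)) (π σ : Equiv.Perm (Fin n)) : ℕ :=
  (Kᶜ.filter fun i => π i = σ i).card

theorem openHits_eq_zero_iff {K : Finset (Fin n)} {π σ : Equiv.Perm (Fin n)} :
    openHits K π σ = 0 ↔ ∀ i ∉ K, π i ≠ σ i := by
  simp [openHits, Finset.filter_eq_empty_iff]

theorem openHits_ne_zero_iff {K : Finset (Fin n)} {π σ : Equiv.Perm (Fin n)} :
    openHits K π σ ≠ 0 ↔ ∃ i ∉ K, π i = σ i := by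
  rw [Ne, openHits_eq_zero_iff]; push Not; rfl

theorem blackPegs_eq_add_openHits (K : Finset (Fin n)) (π σ : Equiv.Perm (Fin n)) :
    blackPegs π σ = (K.filter fun i => π i = σ i).card + openHits K π σ := by
  rw [openHits, ← Finset.card_union_of_disjoint, ← Finset.filter_union, Finset.union_compl]
  · rfl
  · exact Finset.disjoint_filter_filter disjoint_compl_right

/-- Given the values of the secret on `K`, a score determines the number of hits outside `K`. -/
theorem openHits_eq_of_blackPegs_eq {K : Finset (Fin n)} {π σ σ' : Equiv.Perm (Fin n)}
    (hK : ∀ i ∈ K, σ i = σ' i) (h : blackPegs π σ = blackPegs π σ') :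
    openHits K π σ = openHits K π σ' := by
  rw [blackPegs_eq_add_openHits K, blackPegs_eq_add_openHits K π σ'] at h
  have : (K.filter fun i => π i = σ i) = K.filter fun i => π i = σ' i :=
    Finset.filter_congr fun i hi => by rw [hK i hi]
  rw [this] at h
  omega

/-- All secrets in `C` take the same values on `K`. -/
def AgreeOn (K : Finset (Fin n)) (C : Set (Equiv.Perm (Fin n))) : Prop :=
  ∀ σ ∈ C, ∀ σ' ∈ C, ∀ i ∈ K, σ i = σ' i

theorem AgreeOn.subset {K : Finset (Fin n)} {C C' : Set (Equiv.Perm (Fin n))}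
    (h : AgreeOn K C) (hC : C' ⊆ C) : AgreeOn K C' :=
  fun σ hσ σ' hσ' => h σ (hC hσ) σ' (hC hσ')

namespace Solvable

variable {k t : ℕ} {π : Equiv.Perm (Fin n)} {C : Set (Equiv.Perm (Fin n))}
  {K : Finset (Fin n)}

theorem move (hk : 2 ≤ k) {π' : Equiv.Perm (Fin n)} (h : Solvable k t π' C) :
    Solvable k (t + (n / (k / 2) + 1)) π C := by
  have := move_forward hk (card_diffSet_swapPath_le π π') 0 n (t := t) (C := C)
    (by rw [swapPath_of_le π π' (by omega)]; exact h)
  exact this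

/-- The answer to the current guess tells whether it has a hit outside the known positions. -/
theorem of_openHits (hK : AgreeOn K C)
    (h0 : Solvable k t π {σ ∈ C | openHits K π σ = 0})
    (h1 : Solvable k t π {σ ∈ C | openHits K π σ ≠ 0}) : Solvable k t π C := by
  refine of_blackPegs fun b => ?_
  rcases Set.eq_empty_or_nonempty {σ ∈ C | blackPegs π σ = b} with he | ⟨σ, hσ⟩
  · rw [he]; exact empty
  · have heq : ∀ σ' ∈ {σ ∈ C | blackPegs π σ = b}, openHits K π σ' = openHits K π σ :=
      fun σ' hσ' => openHits_eq_of_blackPegs_eq (hK σ' hσ'.1 σ hσ.1) (hσ'.2.trans hσ.2.symm)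
    by_cases hz : openHits K π σ = 0
    · exact h0.subset fun σ' hσ' => ⟨hσ'.1, (heq σ' hσ').trans hz⟩
    · exact h1.subset fun σ' hσ' => ⟨hσ'.1, by rw [heq σ' hσ']; exact hz⟩

/-- Binary search on a path of transpositions for a place where open hits appear. The distances
between consecutive queries are `2 ^ (r - 1), …, 2, 1`, so that locality costs only
`2 ^ r / (k / 2)` guesses beyond the `r` queries. -/
theorem binary_search (hk : 2 ≤ k) {p : ℕ → Equiv.Perm (Fin n)}
    (hp : ∀ i, (diffSet (p i) (p (i + 1))).card ≤ 2) (hK : AgreeOn K C)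
    (hend : ∀ l π, ∀ C' ⊆ C, (∀ σ ∈ C', openHits K (p l) σ = 0) →
      (∀ σ ∈ C', openHits K (p (l + 1)) σ ≠ 0) → Solvable k t π C')
    (r lo : ℕ) {C' : Set (Equiv.Perm (Fin n))} (hC' : C' ⊆ C)
    (hlo : ∀ σ ∈ C', openHits K (p lo) σ = 0)
    (hhi : ∀ σ ∈ C', openHits K (p (lo + 2 ^ r)) σ ≠ 0)
    (hπ : π = p lo ∨ π = p (lo + 2 ^ r)) :
    Solvable k (t + (2 ^ r / (k / 2) + r)) π C' := by
  induction r generalizing lo C' π with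
  | zero => exact (hend lo π C' hC' hlo hhi).mono (Nat.le_add_right _ _)
  | succ r ih =>
    have hpow : lo + 2 ^ (r + 1) = lo + 2 ^ r + 2 ^ r := by ring
    have hmid : Solvable k (t + (2 ^ r / (k / 2) + r)) (p (lo + 2 ^ r)) C' := by
      refine of_openHits (hK.subset hC') ?_ ?_
      · exact ih (lo + 2 ^ r) (fun σ hσ => hC' hσ.1) (fun σ hσ => hσ.2)
          (fun σ hσ => by rw [← hpow]; exact hhi σ hσ.1) (Or.inl rfl)
      · exact ih lo (fun σ hσ => hC' hσ.1) (fun σ hσ => hlo σ hσ.1) (fun σ hσ => hσ.2)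
          (Or.inr rfl)
    have hdiv : 2 ^ r / (k / 2) + 2 ^ r / (k / 2) ≤ 2 ^ (r + 1) / (k / 2) := by
      rw [pow_succ, mul_two]; exact Nat.div_add_div_le_add_div
    rcases hπ with rfl | rfl
    · exact (move_forward hk hp lo (2 ^ r) hmid).mono (by omega)
    · rw [hpow]
      exact (move_backward hk hp (lo + 2 ^ r) (2 ^ r) hmid).mono (by omega)

end Solvable

/-- If `h` has no open hit and `h * swap a b` has one, a single further guess tells which of the
two changed positions carries an open hit. -/
theorem openHits_three_cycle {K : Finset (Fin n)} {h σ : Equiv.Perm (Fin n)} {a b d : Fin n}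
    (hda : d ≠ a) (hdb : d ≠ b) (h0 : openHits K h σ = 0)
    (h1 : openHits K (h * Equiv.swap a b) σ ≠ 0) :
    (openHits K (h * Equiv.swap a b * Equiv.swap b d) σ ≠ 0 → a ∉ K ∧ σ a = h b) ∧
    (openHits K (h * Equiv.swap a b * Equiv.swap b d) σ = 0 → b ∉ K ∧ σ b = h a) := by
  rw [openHits_eq_zero_iff] at h0
  have hab : a ≠ b := by
    rintro rfl
    simp only [Equiv.swap_self] at h1
    exact h1 (openHits_eq_zero_iff.2 h0)
  have hca : (h * Equiv.swap a b * Equiv.swap b d) a = h b := by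
    simp [Equiv.swap_apply_of_ne_of_ne hab hda.symm]
  have hor : (a ∉ K ∧ σ a = h b) ∨ (b ∉ K ∧ σ b = h a) := by
    obtain ⟨i, hi, he⟩ := openHits_ne_zero_iff.1 h1
    rw [Equiv.Perm.mul_apply] at he
    by_cases hia : i = a
    · subst hia; rw [Equiv.swap_apply_left] at he; exact Or.inl ⟨hi, he.symm⟩
    by_cases hib : i = b
    · subst hib; rw [Equiv.swap_apply_right] at he; exact Or.inr ⟨hi, he.symm⟩
    rw [Equiv.swap_apply_of_ne_of_ne hia hib] at he
    exact absurd he (h0 i hi)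
  constructor
  · intro hne
    rcases hor with hor | ⟨hb, hσb⟩
    · exact hor
    · obtain ⟨i, hi, he⟩ := openHits_ne_zero_iff.1 hne
      -- as `σ b = h a`, the new values at `b` and `d` are both wrong
      by_cases hia : i = a
      · subst hia; rw [hca] at he; exact ⟨hi, he.symm⟩
      exfalso
      by_cases hib : i = b
      · subst hib
        simp only [Equiv.Perm.mul_apply, Equiv.swap_apply_left,
          Equiv.swap_apply_of_ne_of_ne hda hdb] at he
        exact hda (h.injective (he.trans hσb))
      by_cases hid : i = d
      · subst hid
        simp only [Equiv.Perm.mul_apply, Equiv.swap_apply_right] at he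
        exact hib (σ.injective (he.symm.trans hσb.symm))
      simp only [Equiv.Perm.mul_apply, Equiv.swap_apply_of_ne_of_ne hib hid,
        Equiv.swap_apply_of_ne_of_ne hia hib] at he
      exact h0 i hi he
  · intro hz
    rcases hor with ⟨ha, hσa⟩ | hor
    · exact absurd (hca.trans hσa.symm) (openHits_eq_zero_iff.1 hz a ha)
    · exact hor

theorem exists_ne_ne (hn : 3 ≤ n) (a b : Fin n) : ∃ d, d ≠ a ∧ d ≠ b := by
  obtain ⟨d, hd⟩ := Finset.exists_mem_notMem_of_card_lt_card (s := {a, b})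
    (t := (Finset.univ : Finset (Fin n)))
    (lt_of_le_of_lt Finset.card_le_two (by rw [Finset.card_univ, Fintype.card_fin]; exact hn))
  simp only [Finset.mem_insert, Finset.mem_singleton, not_or] at hd
  exact ⟨d, hd.2.1, hd.2.2⟩

/-! ### Finding the secret value by value -/

/-- The number of guesses allotted to finding one more value of the secret: go to the reference
guess, search, and make one test guess. -/
def searchCost (n k : ℕ) : ℕ :=
  (n / (k / 2) + 1) + (2 ^ Nat.clog 2 n / (k / 2) + Nat.clog 2 n) + (n / (k / 2) + 1)

/-- If the secrets in `C` agree on `K`, some reference guess `g` has score `0`, and every pair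
(position, value) occurs in a guess with known score, then the values outside `K` can be found
one at a time. -/
theorem solvable_of_agreeOn {k : ℕ} (hn : 3 ≤ n) (hk : 2 ≤ k) {g : Equiv.Perm (Fin n)}
    (m : ℕ) : ∀ {K : Finset (Fin n)} {C : Set (Equiv.Perm (Fin n))} {π : Equiv.Perm (Fin n)},
    Kᶜ.card = m → AgreeOn K C → (∀ σ ∈ C, blackPegs g σ = 0) →
    (∀ i x, ∃ s : Equiv.Perm (Fin n), s i = x ∧
      ∀ σ ∈ C, ∀ σ' ∈ C, blackPegs s σ = blackPegs s σ') →
    Solvable k (m * searchCost n k + (n / (k / 2) + 1)) π C := by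
  induction m with
  | zero =>
    intro K C π hm hK _ _
    rcases Set.eq_empty_or_nonempty C with rfl | ⟨σ, hσ⟩
    · exact Solvable.empty
    rw [zero_mul]
    refine Solvable.move hk (π' := σ) (t := 0) fun σ' hσ' => Equiv.ext fun i => ?_
    refine hK σ' hσ' σ hσ i ?_
    rw [Finset.card_eq_zero, Finset.compl_eq_empty_iff] at hm
    simp [hm]
  | succ m ih =>
    intro K C π hm hK hg hs
    rcases Set.eq_empty_or_nonempty C with rfl | ⟨σ, hσ⟩
    · exact Solvable.empty
    obtain ⟨i, hi⟩ : Kᶜ.Nonempty := Finset.card_pos.1 (by omega)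
    obtain ⟨s, hsi, hsC⟩ := hs i (σ i)
    have hlow : ∀ σ' ∈ C, openHits K g σ' = 0 := fun σ' hσ' => by
      have := hg σ' hσ'
      rw [blackPegs_eq_add_openHits K] at this
      omega
    have hhigh : ∀ σ' ∈ C, openHits K s σ' ≠ 0 := fun σ' hσ' => by
      rw [openHits_eq_of_blackPegs_eq (hK σ' hσ' σ hσ) (hsC σ' hσ' σ hσ)]
      exact openHits_ne_zero_iff.2 ⟨i, Finset.mem_compl.1 hi, hsi⟩
    -- once the value at a new position `a` is known, the induction hypothesis applies
    have hnew : ∀ {C' : Set (Equiv.Perm (Fin n))} {π : Equiv.Perm (Fin n)} (a x : Fin n),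
        C' ⊆ C → (∀ σ ∈ C', a ∉ K ∧ σ a = x) →
        Solvable k (m * searchCost n k + (n / (k / 2) + 1)) π C' := by
      intro C' π a x hC' ha
      rcases Set.eq_empty_or_nonempty C' with rfl | ⟨ρ, hρ⟩
      · exact Solvable.empty
      refine ih (K := insert a K) ?_ ?_ (fun σ h => hg σ (hC' h)) fun i x => ?_
      · have h1 := Finset.card_insert_of_notMem (ha ρ hρ).1
        have h2 := Finset.card_compl_add_card K
        have h3 := Finset.card_compl_add_card (insert a K)
        omega
      · intro σ h σ' h' j hj
        rcases Finset.mem_insert.1 hj with rfl | hj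
        · rw [(ha σ h).2, (ha σ' h').2]
        · exact hK σ (hC' h) σ' (hC' h') j hj
      · obtain ⟨s, hs1, hs2⟩ := hs i x
        exact ⟨s, hs1, fun σ h σ' h' => hs2 σ (hC' h) σ' (hC' h')⟩
    have hsearch := Solvable.binary_search (π := g) (r := Nat.clog 2 n) (lo := 0)
      (t := m * searchCost n k + (n / (k / 2) + 1) + (n / (k / 2) + 1)) hk
      (card_diffSet_swapPath_le g s) hK ?_ subset_rfl hlow
      (by rw [swapPath_of_le g s (by simpa using Nat.le_pow_clog one_lt_two n)]
          exact hhigh)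
      (Or.inl rfl)
    · exact (Solvable.move hk hsearch).mono (by rw [add_mul, one_mul, searchCost]; omega)
    · intro l π C' hC' h0 h1
      obtain ⟨a, b, hab⟩ := swapPath_succ (by omega) g s l
      obtain ⟨d, hda, hdb⟩ := exists_ne_ne hn a b
      rw [hab] at h1
      -- a guess differing from the path by a 3-cycle tells which of the two new values is a hit
      refine Solvable.move hk
        (π' := swapPath g s l * Equiv.swap a b * Equiv.swap b d) ?_
      refine Solvable.of_openHits (hK.subset hC') ?_ ?_
      · exact hnew b (swapPath g s l a) (fun σ h => hC' h.1) fun σ h =>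
          (openHits_three_cycle hda hdb (h0 σ h.1) (h1 σ h.1)).2 h.2
      · exact hnew a (swapPath g s l b) (fun σ h => hC' h.1) fun σ h =>
          (openHits_three_cycle hda hdb (h0 σ h.1) (h1 σ h.1)).1 h.2

/-- Guess all permutations of a list and record the scores. -/
theorem Solvable.of_list {k t : ℕ} (hk : 2 ≤ k) (L : List (Equiv.Perm (Fin n)))
    {C : Set (Equiv.Perm (Fin n))} (π : Equiv.Perm (Fin n))
    (h : ∀ (π : Equiv.Perm (Fin n)) (v : Equiv.Perm (Fin n) → ℕ),
      Solvable k t π {σ ∈ C | ∀ s ∈ L, blackPegs s σ = v s}) :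
    Solvable k (t + L.length * (n / (k / 2) + 1)) π C := by
  classical
  induction L generalizing C π with
  | nil => exact (h π fun _ => 0).subset (fun σ hσ => ⟨hσ, by simp⟩) |>.mono (by omega)
  | cons s L ih =>
    have := Solvable.move (π := π) hk (π' := s)
      (t := t + L.length * (n / (k / 2) + 1)) (C := C) <| .of_blackPegs fun b =>
        ih (C := {σ ∈ C | blackPegs s σ = b}) s fun π v => ?_
    · exact this.mono (by rw [List.length_cons, add_mul]; omega)
    · refine (h π (fun s' => if s' = s then b else v s')).subset ?_
      rintro σ ⟨⟨hσ, hb⟩, hv⟩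
      refine ⟨hσ, fun s' hs' => ?_⟩
      split_ifs with he
      · rw [he, hb]
      · exact hv s' ((List.mem_cons.1 hs').resolve_left he)

/-- Every secret has score `0` against a cyclic shift, or against the identity with one position
swapped away: the scores of the `n` shifts add up to `n`, so if none vanishes, then the identity
has exactly one hit, and exchanging it with any other position destroys it. -/
theorem exists_blackPegs_eq_zero [NeZero n] (e : Fin n → Fin n) (he : ∀ p, e p ≠ p)
    (σ : Equiv.Perm (Fin n)) :
    (∃ j : Fin n, blackPegs (Equiv.addRight j) σ = 0) ∨
      ∃ p, blackPegs (Equiv.swap p (e p)) σ = 0 := by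
  by_contra! hcon
  have hsum : ∑ j : Fin n, blackPegs (Equiv.addRight j) σ = n := by
    have := Finset.card_eq_sum_card_fiberwise (f := fun i => σ i - i)
      (s := (Finset.univ : Finset (Fin n))) (t := Finset.univ) (by simp)
    rw [Finset.card_univ, Fintype.card_fin] at this
    conv_rhs => rw [this]
    refine Finset.sum_congr rfl fun j _ => congrArg Finset.card (Finset.filter_congr fun i _ => ?_)
    rw [Equiv.coe_addRight, sub_eq_iff_eq_add, eq_comm, add_comm]
  have hone : blackPegs (Equiv.addRight (0 : Fin n)) σ = 1 := by
    have h1 : ∑ j : Fin n, 1 = ∑ j : Fin n, blackPegs (Equiv.addRight j) σ := by simp [hsum]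
    exact ((Finset.sum_eq_sum_iff_of_le fun j _ => Nat.one_le_iff_ne_zero.2 (hcon.1 j)).1 h1 0
      (Finset.mem_univ _)).symm
  obtain ⟨p, hp⟩ := Finset.card_eq_one.1 hone
  have hp' : ∀ i, i = σ i ↔ i = p := fun i => by
    simpa using congrArg (fun s => i ∈ s) hp
  refine hcon.2 p (Finset.card_eq_zero.2 (Finset.filter_eq_empty_iff.2 fun i _ hi => ?_))
  have hσp := (hp' p).2 rfl
  by_cases h1 : i = p
  · subst h1
    rw [Equiv.swap_apply_left] at hi
    exact he i (hi.trans hσp.symm)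
  by_cases h2 : i = e p
  · rw [h2, Equiv.swap_apply_right] at hi
    exact he p (σ.injective (hi.symm.trans hσp))
  rw [Equiv.swap_apply_of_ne_of_ne h1 h2] at hi
  exact h1 ((hp' i).1 hi)

/-- The full strategy: the cyclic shifts together with the swaps of the identity supply both the
reference guess of score `0` and a guess with known score through every pair. -/
theorem solvable_univ {k : ℕ} (hn : 3 ≤ n) (hk : 2 ≤ k) (π : Equiv.Perm (Fin n)) :
    Solvable k (n * searchCost n k + (n / (k / 2) + 1) + 2 * n * (n / (k / 2) + 1)) π
      Set.univ := by
  have : NeZero n := ⟨by omega⟩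
  have : Nontrivial (Fin n) := Fin.nontrivial_iff_two_le.2 (by omega)
  choose e he using fun p : Fin n => exists_ne p
  let L : List (Equiv.Perm (Fin n)) :=
    (List.finRange n).map (fun j => Equiv.addRight j) ++
      (List.finRange n).map fun p => Equiv.swap p (e p)
  have hL : L.length = 2 * n := by simp [L]; ring
  rw [← hL]
  refine Solvable.of_list hk L π fun π v => ?_
  rcases Set.eq_empty_or_nonempty {σ ∈ Set.univ | ∀ s ∈ L, blackPegs s σ = v s} with h | ⟨σ, hσ⟩
  · rw [h]; exact Solvable.empty
  obtain ⟨g, hgL, hg⟩ : ∃ g ∈ L, blackPegs g σ = 0 := by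
    rcases exists_blackPegs_eq_zero e he σ with ⟨j, hj⟩ | ⟨p, hp⟩
    · exact ⟨_, by simp [L], hj⟩
    · exact ⟨_, by simp [L], hp⟩
  refine solvable_of_agreeOn hn hk (g := g) n (K := ∅) (by simp) (fun _ _ _ _ i hi => by simp at hi)
    (fun σ' hσ' => ?_) fun i x => ⟨Equiv.addRight (x - i), by simp, fun σ h σ' h' => ?_⟩
  · rw [hσ'.2 g hgL, ← hσ.2 g hgL, hg]
  · have hmem : Equiv.addRight (x - i) ∈ L := by simp [L]
    rw [h.2 _ hmem, h'.2 _ hmem]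

/-- For `n = 2` there is no third position to test with, but the second of the two permutations is
at most two changes away. -/
theorem solvable_two {k : ℕ} (hk : 2 ≤ k) :
    Solvable k 1 (1 : Equiv.Perm (Fin 2)) Set.univ := by
  intro b
  by_cases hb : b = 2
  · refine ⟨1, by simp [card_diffSet_self], fun σ hσ => ?_⟩
    exact (blackPegs_eq_iff.1 (hσ.2.trans hb)).symm
  · refine ⟨Equiv.swap 0 1, (Finset.card_le_univ _).trans (by simpa using hk), fun σ hσ => ?_⟩
    have h1 : σ ≠ 1 := by
      rintro rfl
      exact hb (hσ.2.symm.trans (blackPegs_eq_iff.2 rfl))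
    have key : ∀ σ : Equiv.Perm (Fin 2), σ ≠ 1 → σ = Equiv.swap 0 1 := by decide
    exact key σ h1

/-! ### The upper bound -/

theorem Solvable.mem_ellWinningBounds {k t : ℕ} {π : Equiv.Perm (Fin n)}
    (h : Solvable k t π Set.univ) : t + 1 ∈ ellWinningBounds n k := by
  obtain ⟨S, -, hloc, hwin⟩ := h.exists_strategy
  exact ⟨S, hloc, fun σ => hwin σ (Set.mem_univ σ)⟩

theorem ellWinningBounds_nonempty {k : ℕ} (hn : 2 ≤ n) (hk : 2 ≤ k) :
    (ellWinningBounds n k).Nonempty := by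
  rcases hn.eq_or_lt with rfl | hn
  · exact ⟨_, (solvable_two hk).mem_ellWinningBounds⟩
  · exact ⟨_, (solvable_univ hn hk 1).mem_ellWinningBounds⟩

theorem clog_two_le_logb (hn : 2 ≤ n) : (Nat.clog 2 n : ℝ) ≤ Real.logb 2 n + 1 := by
  rw [← Real.natCeil_logb_natCast]
  exact (Nat.ceil_lt_add_one (Real.logb_nonneg (by norm_num) (by norm_cast; omega))).le

theorem two_pow_clog_le (hn : 2 ≤ n) : 2 ^ Nat.clog 2 n ≤ 2 * n := by
  have h := Nat.pow_pred_clog_lt_self one_lt_two (x := n) (by omega)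
  have hpos : 0 < Nat.clog 2 n := Nat.clog_pos one_lt_two hn
  have : 2 ^ Nat.clog 2 n = 2 ^ (Nat.clog 2 n).pred * 2 := by
    rw [← pow_succ, Nat.pred_eq_sub_one, Nat.sub_add_cancel hpos]
  omega

/-- Rounding `k / 2` down costs at most a factor `3 / 2`, attained at `k = 3`. -/
theorem cast_div_half_le {k : ℕ} (hk : 2 ≤ k) (d : ℕ) :
    ((d / (k / 2) : ℕ) : ℝ) ≤ 3 * d / k := by
  have hk0 : (0 : ℝ) < k := by positivity
  have hq : 0 < k / 2 := by omega
  refine Nat.cast_div_le.trans ?_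
  rw [div_le_div_iff₀ (by exact_mod_cast hq) hk0]
  have : (k : ℝ) ≤ 3 * (k / 2 : ℕ) := by exact_mod_cast (by omega : k ≤ 3 * (k / 2))
  nlinarith [Nat.cast_nonneg (α := ℝ) d]

/-- Each of the `n` values costs `lg n` search queries; all else, including the guesses needed
for locality, is `O(n / k)` per value because `1 ≤ n / k`. -/
theorem adaptiveEll_le_add {k : ℕ} (hn : 2 ≤ n) (hk : 2 ≤ k) (hkn : k ≤ n) :
    (adaptiveEll n k : ℝ) ≤ n * Real.logb 2 n + 28 * ((n : ℝ) ^ 2 / k) := by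
  have hk0 : (0 : ℝ) < k := by positivity
  have hx : 1 ≤ (n : ℝ) / k := by rw [one_le_div hk0]; exact_mod_cast hkn
  have hn2 : (2 : ℝ) ≤ n := by exact_mod_cast hn
  have hlog : 0 ≤ Real.logb 2 n := Real.logb_nonneg (by norm_num) (by linarith)
  have hsq : (n : ℝ) ^ 2 / k = n * (n / k) := by ring
  rcases hn.eq_or_lt with rfl | hn3
  · have h : adaptiveEll 2 k ≤ 1 + 1 := Nat.sInf_le (solvable_two hk).mem_ellWinningBounds
    have h' : (adaptiveEll 2 k : ℝ) ≤ 2 := by exact_mod_cast h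
    have h1 : 0 ≤ ((2 : ℕ) : ℝ) * Real.logb 2 (2 : ℕ) := by positivity
    have h2 : (2 : ℝ) * 1 ≤ ((2 : ℕ) : ℝ) * ((2 : ℕ) / k) := by gcongr
    rw [hsq]
    generalize ((2 : ℕ) : ℝ) * Real.logb 2 (2 : ℕ) = x at *
    generalize ((2 : ℕ) : ℝ) * ((2 : ℕ) / k) = y at *
    linarith
  · have h := Nat.sInf_le (solvable_univ hn3 hk 1).mem_ellWinningBounds
    have h' : (adaptiveEll n k : ℝ) ≤ _ := Nat.cast_le.2 h
    refine h'.trans ?_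
    have hd1 := cast_div_half_le hk n
    have hd2 := cast_div_half_le hk (2 ^ Nat.clog 2 n)
    have hp : ((2 ^ Nat.clog 2 n : ℕ) : ℝ) ≤ 2 * n := by exact_mod_cast two_pow_clog_le hn
    have hd3 : ((2 ^ Nat.clog 2 n / (k / 2) : ℕ) : ℝ) ≤ 6 * (n / k) := by
      refine hd2.trans ?_
      rw [div_le_iff₀ hk0, mul_assoc, div_mul_cancel₀ _ hk0.ne']
      linarith
    have hc := clog_two_le_logb hn
    have hA : ((n / (k / 2) : ℕ) : ℝ) + 1 ≤ 4 * (n / k) := by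
      rw [mul_div_assoc] at hd1
      linarith
    have hS : (searchCost n k : ℝ) ≤ Real.logb 2 n + 15 * (n / k) := by
      simp only [searchCost, Nat.cast_add, Nat.cast_one]
      linarith
    have h1 : (n : ℝ) * searchCost n k ≤ n * (Real.logb 2 n + 15 * (n / k)) := by gcongr
    have h2 : 2 * (n : ℝ) * (((n / (k / 2) : ℕ) : ℝ) + 1) ≤ 2 * n * (4 * (n / k)) := by gcongr
    have h3 : (n : ℝ) / k * 2 ≤ n / k * n := by gcongr
    simp only [Nat.cast_add, Nat.cast_mul, Nat.cast_one, Nat.cast_ofNat]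
    rw [hsq]
    nlinarith

end

theorem theorem1 :
    (∀ n k : ℕ, 2 ≤ n → 2 ≤ k →
      IsLeast (ellWinningBounds n k) (adaptiveEll n k) ∧
      ((n : ℝ) ^ 2 - 3 * (n : ℝ)) / (2 * (k : ℝ)) ≤ (adaptiveEll n k : ℝ)) ∧
    (∃ ε : ℕ → ℝ, Tendsto ε atTop (𝓝 0) ∧
      ∀ n k : ℕ, 2 ≤ n → 2 ≤ k → k ≤ n →
        (adaptiveEll n k : ℝ) ≤ (n : ℝ) ^ 2 * Real.logb 2 (n : ℝ) / (k : ℝ) * (1 + ε n)) := by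
  refine ⟨fun n k hn hk => ?_, fun n => 28 / Real.logb 2 n, ?_, fun n k hn hk hkn => ?_⟩
  · have hmem := Nat.sInf_mem (ellWinningBounds_nonempty hn hk)
    refine ⟨⟨hmem, fun T hT => Nat.sInf_le hT⟩, ?_⟩
    have h : (n : ℝ) * n ≤ 2 * (adaptiveEll n k * k) + 3 * n := by
      exact_mod_cast sq_le_of_mem_ellWinningBounds hn hmem
    rw [div_le_iff₀ (by positivity)]
    nlinarith
  · exact tendsto_const_nhds.div_atTop
      ((Real.tendsto_logb_atTop one_lt_two).comp tendsto_natCast_atTop_atTop)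
  · have hn2 : (2 : ℝ) ≤ n := by exact_mod_cast hn
    have hk0 : (0 : ℝ) < k := by positivity
    have hlog : 0 < Real.logb 2 n := Real.logb_pos one_lt_two (by linarith)
    have hx : 1 ≤ (n : ℝ) / k := by rw [one_le_div hk0]; exact_mod_cast hkn
    calc (adaptiveEll n k : ℝ) ≤ n * Real.logb 2 n + 28 * ((n : ℝ) ^ 2 / k) :=
          adaptiveEll_le_add hn hk hkn
      _ ≤ n * Real.logb 2 n * (n / k) + 28 * ((n : ℝ) ^ 2 / k) := by
          have := le_mul_of_one_le_right (a := n * Real.logb 2 n) (by positivity) hx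
          linarith
      _ = _ := by field_simp
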